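/- **Setting.** Work is measured in the asymmetric memory model: a write to the large memory costs $\omega\ge 1$, every other operation costs $1$; a tree node is a record of constantly many words. Let $\alpha\ge 2$ be an integer. The *weight* (size) of a (sub)tree is its number of nodes plus one. **Data structure.** A set of keys is kept in a binary search tree in which only *critical* nodes carry balancing information: the current weight of their subtree and the *initial weight* it had when the node was labelled. When a perfectly balanced (sub)tree is constructed, a node of weight $w$ is labelled critical iff for some integer $i\ge 0$ either $2\alpha^i\le w\le 4\alpha^i-2$, or $w=2\alpha^i-1$ and its sibling has weight $2\alpha^i$; the root of the whole tree is always treated as critical. *Insertion.* Search for the key; if it is absent, attach a new leaf (critical, initial weight $2$) and increment the weights stored at the critical nodes on the search path. If then some critical node on the path has reached twice its initial weight $s$, the subtree of the topmost such node is reconstructed in a perfectly balanced way, in a number of reads and writes linear in its size, and relabelled, except that the new root of a reconstructed proper subtree is not marked if $s\le 4\alpha^i-2$ and $2\alpha^{i+1}-1\le 2s$ for some integer $i\ge 0$. If the key is present but marked as deleted, it is unmarked; if it is already live, nothing changes. *Deletion.* Search for the key and, if it is live, mark it as deleted; marked nodes keep counting towards weights and stay in place when a proper subtree is reconstructed. Once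 at least half of all nodes are marked, the whole tree is reconstructed from the live keys. (Marked nodes are also dropped when the whole tree is reconstructed because the weight of the root has doubled.) **Theorem.** There is an absolute constant $C>0$ such that for every linearly ordered type of keys, every integer $\alpha\ge2$, every real $\omega\ge1$, every finite set $S$ of keys and every finite sequence of $m$ updates (insertions and deletions in any order) performed on the freshly constructed and labelled tree on $S$: 1. after the updates the tree is a search tree whose live keys are exactly those in the set obtained from $S$ by the updates, the number of marked nodes is recorded correctly, the root of a nonempty tree is critical, and each critical node stores its correct current weight, which is at least its initial weight and less than twice its initial weight; 2. the total work of the updates (searching, maintaining the balancing information, and all reconstructions) is at most $$C\sum_{j=1}^{m}(\omega+\alpha)\,\max\{1,\log_\alpha n_j\},$$ where $n_j$ is the number of live keys plus one just before the $j$-th update. That is, the amortized cost per insertion or deletion on a tree of size $n$ is $O((\omega+\alpha)\log_\alpha n)$, where $\log_\alpha n$ is read as $1$ when $n<\alpha$. -/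

import Mathlib

universe u v

namespace AlphaLabeling

/-! ### Cost accounting in the asymmetric memory model

A computation returns its value together with the number of unit-cost steps it performs (reads of
the large memory, each with the constantly many local operations that go with it) and the number of
writes to the large memory. A write costs `ω`, every other step costs `1`. A tree node, an array
cell and a counter are records of constantly many words; accessing one is one read or one write. -/

structure Counted (A : Type u) where
  val : A
  reads : ℕ
  writes : ℕ

namespace Counted

/-- A result at no cost. -/
def ret {A : Type u} (a : A) : Counted A := ⟨a, 0, 0⟩

/-- Perform `r` reads and `w` writes, then run `c`. -/
def charge {A : Type u} (r w : ℕ) (c : Counted A) : Counted A :=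
  ⟨c.val, r + c.reads, w + c.writes⟩

/-- Sequential composition; costs add up. -/
def bind {A : Type u} {B : Type v} (c : Counted A) (f : A → Counted B) : Counted B :=
  ⟨(f c.val).val, c.reads + (f c.val).reads, c.writes + (f c.val).writes⟩

/-- The work: reads plus `ω` times writes. -/
def work {A : Type u} (ω : ℝ) (c : Counted A) : ℝ := (c.reads : ℝ) + ω * (c.writes : ℝ)

end Counted

/-! ### Binary search trees with balancing information at critical nodes only -/

/-- The balancing information of a critical node: the subtree weight at the time when the node was
labelled, and the current subtree weight. -/
structure BalanceInfo where
  initial : ℕ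
  weight : ℕ

/-- A binary tree. A node stores a key, a flag telling whether the key is live (`true`) or marked as
deleted (`false`), and balancing information if and only if it is a critical node
(`none` means: secondary node). -/
inductive LTree (K : Type u) where
  | nil : LTree K
  | node (left : LTree K) (key : K) (live : Bool) (info : Option BalanceInfo) (right : LTree K) :
      LTree K

namespace LTree

variable {K : Type u}

/-- The weight (size) of a subtree: its number of nodes (live or marked) plus one. It is the sum of
the weights of the two children. -/
def weight : LTree K → ℕ
  | nil => 1
  | node l _ _ _ r => l.weight + r.weight

/-- The keys with their flags, in symmetric order. -/
def entries : LTree K → List (K × Bool)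
  | nil => []
  | node l k b _ r => l.entries ++ (k, b) :: r.entries

/-- Every critical node knows its current subtree weight, and that weight is less than twice
the initial weight. -/
def InfoCorrect : LTree K → Prop
  | nil => True
  | node l k b info r =>
      (∀ c ∈ info, c.weight = (node l k b info r).weight ∧
        c.initial ≤ c.weight ∧ c.weight < 2 * c.initial) ∧
      l.InfoCorrect ∧ r.InfoCorrect

/-- The root of a nonempty tree is a (virtual) critical node. -/
def RootCritical : LTree K → Prop
  | nil => True
  | node _ _ _ info _ => info.isSome

end LTree

/-! ### The labeling rule -/

/-- In a freshly constructed tree, a non-root node of weight `w` whose sibling has weight `sib` is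
critical iff for some `i ≥ 0` (1) `2α^i ≤ w ≤ 4α^i - 2`, or (2) `w = 2α^i - 1` and
`sib = 2α^i`. -/
def IsCritical (α w sib : ℕ) : Prop :=
  ∃ i : ℕ, (2 * α ^ i ≤ w ∧ w + 2 ≤ 4 * α ^ i) ∨ (w + 1 = 2 * α ^ i ∧ sib = 2 * α ^ i)

/-- Whether the new root, of weight `w`, is critical after the reconstruction of the subtree of a
non-root critical node with initial weight `s`. At that moment `w = 2 * s` is even, so that only
rule (1) can apply. Exception: the new root is not marked if `s ≤ 4α^i - 2` and
`2α^(i+1) - 1 ≤ 2s` for some `i`. -/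
def IsCriticalAfterRebuild (α s w : ℕ) : Prop :=
  (∃ i : ℕ, 2 * α ^ i ≤ w ∧ w + 2 ≤ 4 * α ^ i) ∧
    ¬ ∃ i : ℕ, s + 2 ≤ 4 * α ^ i ∧ 2 * α ^ (i + 1) ≤ 2 * s + 1

/-! ### Reconstruction -/

section Algorithm

variable {K : Type u}

/-- The label written at a node of weight `w` when it is constructed. -/
def freshInfo (mark : Bool) (w : ℕ) : Option BalanceInfo :=
  if mark then some ⟨w, w⟩ else none

/-- Write the entries of a tree, in order, in front of `acc`. Per node: one read of the node,
one write of the output cell and one write to the traversal stack. -/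
def flatten : LTree K → List (K × Bool) → Counted (List (K × Bool))
  | .nil, acc => Counted.ret acc
  | .node l k b _ r, acc =>
      Counted.charge 1 2 ((flatten r acc).bind fun acc' => flatten l ((k, b) :: acc'))

open scoped Classical in
/-- Construct the perfectly balanced tree with the given entries and label its nodes; `mark` tells
whether the root is critical. The list stands for an array, its sublists for ranges of
indices. Per node: one read of the median of the range, one write of the node and one write to the
recursion stack. The level `i` in the labeling rule changes by at most one from a node to its child,
so that labeling a node takes constantly many local operations. -/
noncomputable def build (α : ℕ) (mark : Bool) (a : List (K × Bool)) : Counted (LTree K) :=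
  match _h : a.drop (a.length / 2) with
  | [] => Counted.ret .nil
  | e :: right =>
      let left := a.take (a.length / 2)
      let wl := left.length + 1
      let wr := right.length + 1
      Counted.charge 1 2
        ((build α (decide (IsCritical α wl wr)) left).bind fun l =>
          (build α (decide (IsCritical α wr wl)) right).bind fun r =>
            Counted.ret (.node l e.1 e.2 (freshInfo mark (wl + wr)) r))
termination_by a.length
decreasing_by
  all_goals
    have h2 := congrArg List.length _h
    simp only [List.length_drop, List.length_cons] at h2
    first
      | (simp only [List.length_take]; omega)
      | omega

open scoped Classical in
/-- Reconstruct the subtree `t` of a non-root critical node with initial weight `s`, relabel it, and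
redirect the pointer to it (one write). Nodes marked as deleted are kept. -/
noncomputable def rebuildSubtree (α s : ℕ) (t : LTree K) : Counted (LTree K) :=
  (flatten t []).bind fun a =>
    Counted.charge 0 1 (build α (decide (IsCriticalAfterRebuild α s (a.length + 1))) a)

/-- Reconstruct the whole tree from its live entries; the root is critical. Dropping the marked
entries is one pass over the array of entries. -/
noncomputable def rebuildAll (α : ℕ) (t : LTree K) : Counted (LTree K) :=
  (flatten t []).bind fun a =>
    Counted.charge a.length (a.length + 1) (build α true (a.filter Prod.snd))

/-! ### Updates -/

variable [LinearOrder K]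

/-- Search for a key: `none` if absent, otherwise its flag. One read per visited node. -/
def search (k : K) : LTree K → Counted (Option Bool)
  | .nil => Counted.charge 1 0 (Counted.ret none)
  | .node l x b _ r =>
      Counted.charge 1 0
        (if k < x then search k l else if x < k then search k r else Counted.ret (some b))

/-- Set the flag of a key that is present. One read per visited node, one write. -/
def setLive (k : K) (live : Bool) : LTree K → Counted (LTree K)
  | .nil => Counted.charge 1 0 (Counted.ret .nil)
  | .node l x b info r =>
      Counted.charge 1 0
        (if k < x then (setLive k live l).bind fun l' => Counted.ret (.node l' x b info r)
         else if x < k then (setLive k live r).bind fun r' => Counted.ret (.node l x b info r')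
         else Counted.charge 0 1 (Counted.ret (.node l x live info r)))

/-- Attach a new leaf for a key that is absent, and increment the weights of the critical nodes on
the search path. The new leaf is critical, with initial weight 2. One read per visited
node, one write per critical node on the path, two writes for the leaf and the pointer to it. -/
def attach (k : K) : LTree K → Counted (LTree K)
  | .nil => Counted.charge 1 2 (Counted.ret (.node .nil k true (some ⟨2, 2⟩) .nil))
  | .node l x b info r =>
      let info' := info.map fun c => (⟨c.initial, c.weight + 1⟩ : BalanceInfo)
      Counted.charge 1 (if info.isSome then 1 else 0)
        (if k < x then (attach k l).bind fun l' => Counted.ret (.node l' x b info' r)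
         else (attach k r).bind fun r' => Counted.ret (.node l x b info' r'))

/-- Whether the weight of a critical node has reached twice its initial weight. -/
def Overflows (c : BalanceInfo) : Prop := 2 * c.initial ≤ c.weight

instance (c : BalanceInfo) : Decidable (Overflows c) := by
  unfold Overflows; infer_instance

/-- Walk down the search path of `k`, from a non-root node, to the topmost critical node that
overflows, and reconstruct its subtree. One read per visited node. -/
noncomputable def rebalance (α : ℕ) (k : K) : LTree K → Counted (LTree K)
  | .nil => Counted.charge 1 0 (Counted.ret .nil)
  | .node l x b info r =>
      let descend :=
        if k < x then (rebalance α k l).bind fun l' => Counted.ret (.node l' x b info r)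
        else if x < k then (rebalance α k r).bind fun r' => Counted.ret (.node l x b info r')
        else Counted.ret (.node l x b info r)
      Counted.charge 1 0
        (match info with
         | none => descend
         | some c =>
             if Overflows c then rebuildSubtree α c.initial (.node l x b info r) else descend)

/-- The balancing information stored at the root (which is critical in all reachable states). -/
def rootInfo : LTree K → BalanceInfo
  | .node _ _ _ (some c) _ => c
  | _ => ⟨1, 1⟩

/-- Rebalance along the search path of `k`, starting at the root: if the root overflows, the whole
tree is reconstructed, otherwise we look for the topmost overflowing node below it. -/
noncomputable def rebalanceBelowRoot (α : ℕ) (k : K) : LTree K → Counted (LTree K)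
  | .nil => Counted.ret .nil
  | .node l x b info r =>
      Counted.charge 1 0
        (if k < x then (rebalance α k l).bind fun l' => Counted.ret (.node l' x b info r)
         else if x < k then (rebalance α k r).bind fun r' => Counted.ret (.node l x b info r')
         else Counted.ret (.node l x b info r))

/-- The data structure: the tree and the number of its nodes that are marked as deleted. -/
structure DynTree (K : Type u) where
  tree : LTree K
  dead : ℕ

/-- Insert a key. Nothing happens if it is live already; if it is marked as deleted, it is revived;
otherwise a leaf is attached and the topmost overflowing critical node is reconstructed. -/
noncomputable def insertKey (α : ℕ) (k : K) (d : DynTree K) : Counted (DynTree K) :=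
  (search k d.tree).bind fun found =>
    match found with
    | some true => Counted.ret d
    | some false =>
        Counted.charge 1 1
          ((setLive k true d.tree).bind fun t => Counted.ret ⟨t, d.dead - 1⟩)
    | none =>
        (attach k d.tree).bind fun t =>
          Counted.charge 1 0
            (if Overflows (rootInfo t) then
              Counted.charge 0 1 ((rebuildAll α t).bind fun t' => Counted.ret ⟨t', 0⟩)
            else (rebalanceBelowRoot α k t).bind fun t' => Counted.ret ⟨t', d.dead⟩)

/-- Delete a key: mark it if it is live. Once at least half of the nodes are marked, the whole tree
is reconstructed from the live keys. -/
noncomputable def deleteKey (α : ℕ) (k : K) (d : DynTree K) : Counted (DynTree K) :=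
  (search k d.tree).bind fun found =>
    match found with
    | some true =>
        (setLive k false d.tree).bind fun t =>
          Counted.charge 2 1
            (if (rootInfo t).weight ≤ 2 * (d.dead + 1) + 1 then
              Counted.charge 0 1 ((rebuildAll α t).bind fun t' => Counted.ret ⟨t', 0⟩)
            else Counted.ret ⟨t, d.dead + 1⟩)
    | _ => Counted.ret d

/-- An update request. -/
inductive Update (K : Type u) where
  | insert (k : K) : Update K
  | delete (k : K) : Update K

/-- Perform one update. -/
noncomputable def Update.perform (α : ℕ) : Update K → DynTree K → Counted (DynTree K)
  | .insert k, d => insertKey α k d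
  | .delete k, d => deleteKey α k d

/-- Perform a sequence of updates; costs add up. -/
noncomputable def performAll (α : ℕ) : List (Update K) → DynTree K → Counted (DynTree K)
  | [], d => Counted.ret d
  | u :: us, d => (u.perform α d).bind fun d' => performAll α us d'

/-- The freshly constructed and labelled tree on a finite set of keys. -/
noncomputable def construct (α : ℕ) (S : Finset K) : DynTree K :=
  ⟨(build α true ((S.sort (· ≤ ·)).map fun k => (k, true))).val, 0⟩

/-- The effect of one update on the represented set of keys. -/
def Update.apply : Update K → Finset K → Finset K
  | .insert k, S => Insert.insert k S
  | .delete k, S => S.erase k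

/-- The effect of a sequence of updates on the represented set of keys. -/
def applyAll (us : List (Update K)) (S : Finset K) : Finset K :=
  us.foldl (fun T u => u.apply T) S

/-- The sizes (number of keys plus one) at the times of the successive updates. -/
def sizes : List (Update K) → Finset K → List ℕ
  | [], _ => []
  | u :: us, S => (S.card + 1) :: sizes us (u.apply S)

/-- The data structure represents `S`: the tree is a search tree whose live keys are the elements of
`S`, the number of marked nodes is recorded, the root is critical, and each critical node holds
correct balancing information. -/
def DynTree.Represents (d : DynTree K) (S : Finset K) : Prop :=
  (d.tree.entries.map Prod.fst).Pairwise (· < ·) ∧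
  (∀ k, (k, true) ∈ d.tree.entries ↔ k ∈ S) ∧
  d.dead = (d.tree.entries.filter fun e => !e.2).length ∧
  d.tree.RootCritical ∧
  d.tree.InfoCorrect

end Algorithm

end AlphaLabeling

/-! Give a critical node level `i` if its initial weight lies in `[2α^i - 1, 4α^i - 2]`; since `α ≥
2`, these intervals are disjoint. The invariant (`Leveled`, `RootLeveled`) says that levels drop by
exactly one between consecutive critical nodes of a path, until level `0`. Secondary nodes between
levels `i + 1` and `i` each hang a sibling subtree of weight at least `2α^i - 1` off the path,
inside a subtree of weight less than `8α^(i+1)`, so there are `O(α)` of them. A path therefore has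
`O(log_α n)` critical nodes and `O(α log_α n)` nodes (`RootLeveled.bounds`): an insertion reads the
latter and writes only to the former.

The invariant holds for fresh trees by the labeling rule (`fitsLevel_half`, `build_leveled`) and
survives reconstructions because the exception for the new root keeps the level unchanged
(`fitsLevel_rebuild`).

Reconstructions are paid by a potential: the growth `weight - initial` summed over critical nodes,
plus the number of marked nodes. An insertion adds at most one unit per critical node on its path, a
deletion adds one unit. When a reconstruction is due, the potential it releases is about half the
number of nodes involved. At least half of the nodes are live (`DynTree.Valid.length_le`), so bounds
in terms of the tree size transfer to the number of live keys. -/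

namespace AlphaLabeling

/-! ### Cost projections. -/

namespace Counted

variable {A : Type u} {B : Type v}

@[simp] lemma ret_val (a : A) : (ret a).val = a := rfl
@[simp] lemma ret_reads (a : A) : (ret a).reads = 0 := rfl
@[simp] lemma ret_writes (a : A) : (ret a).writes = 0 := rfl
@[simp] lemma charge_val (r w : ℕ) (c : Counted A) : (charge r w c).val = c.val := rfl
@[simp] lemma charge_reads (r w : ℕ) (c : Counted A) :
    (charge r w c).reads = r + c.reads := rfl
@[simp] lemma charge_writes (r w : ℕ) (c : Counted A) :
    (charge r w c).writes = w + c.writes := rfl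
@[simp] lemma bind_val (c : Counted A) (f : A → Counted B) :
    (c.bind f).val = (f c.val).val := rfl
@[simp] lemma bind_reads (c : Counted A) (f : A → Counted B) :
    (c.bind f).reads = c.reads + (f c.val).reads := rfl
@[simp] lemma bind_writes (c : Counted A) (f : A → Counted B) :
    (c.bind f).writes = c.writes + (f c.val).writes := rfl

end Counted

/-! ### Levels, critical depth and height. -/

namespace LTree

variable {K : Type u}

lemma weight_eq (t : LTree K) : t.weight = t.entries.length + 1 := by
  induction t with
  | nil => rfl
  | node l k b info r ihl ihr => simp [weight, entries, ihl, ihr]; omega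

lemma one_le_weight (t : LTree K) : 1 ≤ t.weight := by
  rw [weight_eq]; omega

/-- The number of nodes on a longest path from the root. -/
def height : LTree K → ℕ
  | nil => 0
  | node l _ _ _ r => max l.height r.height + 1

/-- The largest number of critical nodes on a path from the root. -/
def critDepth : LTree K → ℕ
  | nil => 0
  | node l _ _ info r => max l.critDepth r.critDepth + if info.isSome then 1 else 0

/-- The number of insertions below each critical node since it was labelled, summed over all
critical nodes. -/
def potential : LTree K → ℕ
  | nil => 0
  | node l _ _ info r =>
      l.potential + r.potential + info.elim 0 fun c => c.weight - c.initial

/-- The topmost critical nodes have level `i`, where a node has level `i` if its initial weight is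
between `2α^i - 1` and `4α^i - 2`, and levels drop by one from a critical node to the next ones
below. An empty tree has level `0`, and no condition is imposed below critical nodes of
level `0`. -/
def Leveled (α : ℕ) : LTree K → ℕ → Prop
  | nil, i => i = 0
  | node l _ _ none r, i => l.Leveled α i ∧ r.Leveled α i
  | node l _ _ (some c) r, i =>
      2 * α ^ i ≤ c.initial + 1 ∧ c.initial + 2 ≤ 4 * α ^ i ∧
        ∀ j, i = j + 1 → l.Leveled α j ∧ r.Leveled α j

/-- The subtrees of the root have some common level `i`, and the initial weight of the root is at
most that of a critical node of level `i + 1`. -/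
def RootLeveled (α : ℕ) : LTree K → Prop
  | nil => True
  | node l _ _ info r =>
      ∃ i, (∀ c ∈ info, c.initial + 2 ≤ 4 * α ^ (i + 1)) ∧ l.Leveled α i ∧ r.Leveled α i

lemma critDepth_le_height (t : LTree K) : t.critDepth ≤ t.height := by
  induction t with
  | nil => rfl
  | node l k b info r ihl ihr => simp only [critDepth, height]; split <;> omega

lemma height_lt_weight (t : LTree K) : t.height < t.weight := by
  induction t with
  | nil => simp [height, weight]
  | node l k b info r ihl ihr =>
    have := l.one_le_weight
    have := r.one_le_weight
    simp only [weight, height]; omega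

section Bounds

variable {α : ℕ}

lemma Leveled.le_weight {t : LTree K} {i : ℕ} (hα : 2 ≤ α) (h : t.Leveled α i)
    (hc : t.InfoCorrect) : 2 * α ^ i ≤ t.weight + 1 := by
  have hp : 0 < α ^ i := by positivity
  induction t with
  | nil => simp only [Leveled] at h; subst h; simp [weight]
  | node l k b info r ihl ihr =>
    cases info with
    | none =>
      have := ihl h.1 hc.2.1
      have := ihr h.2 hc.2.2
      simp only [weight]; omega
    | some c =>
      have h1 := hc.1 c rfl
      have h2 := h.1
      omega

/-- Each critical node uses up one level; the extra `2` is for the unconstrained subtree at level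
`0`. -/
lemma Leveled.critDepth_le {t : LTree K} {i : ℕ} (h : t.Leveled α i)
    (hc : t.InfoCorrect) : t.critDepth ≤ i + 2 := by
  induction t generalizing i with
  | nil => simp [critDepth]
  | node l k b info r ihl ihr =>
    cases info with
    | none =>
      have := ihl h.1 hc.2.1
      have := ihr h.2 hc.2.2
      simp only [critDepth]; simp; omega
    | some c =>
      cases i with
      -- A critical node of level `0` has initial weight at most `2`, hence weight at most `3`: its
      -- subtree has at most two nodes.
      | zero =>
        have h1 := hc.1 c rfl
        have h2 := h.2.1
        have h3 := critDepth_le_height (node l k b (some c) r)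
        have h4 := height_lt_weight (node l k b (some c) r)
        simp at h2
        omega
      | succ j =>
        obtain ⟨hl, hr⟩ := h.2.2 j rfl
        have := ihl hl hc.2.1
        have := ihr hr hc.2.2
        simp only [critDepth]; simp; omega

/-- Here `q` bounds the run of secondary nodes at the top. Keeping it separate, with its price in
weight, lets the induction pass secondary nodes; the next critical node above converts it into at
most `8 * α`. -/
lemma Leveled.height_le {t : LTree K} {i : ℕ} (hα : 2 ≤ α) (h : t.Leveled α i)
    (hc : t.InfoCorrect) :
    ∃ q, q * (2 * α ^ i - 1) ≤ t.weight ∧ t.height ≤ q + (8 * α + 1) * i + 2 := by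
  induction t generalizing i with
  | nil => exact ⟨0, by simp, by simp [height]⟩
  | node l k b info r ihl ihr =>
    have hp : 0 < α ^ i := by positivity
    cases info with
    | none =>
      obtain ⟨p, hp1, hp2⟩ := ihl h.1 hc.2.1
      obtain ⟨q, hq1, hq2⟩ := ihr h.2 hc.2.2
      have hl := h.1.le_weight hα hc.2.1
      have hr := h.2.le_weight hα hc.2.2
      refine ⟨max p q + 1, ?_, ?_⟩
      · rw [add_mul, one_mul, weight]
        rcases max_cases p q with h | h <;> rw [h.1] <;> omega
      · simp only [height]; omega
    | some c =>
      have h1 := hc.1 c rfl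
      have h2 := h.2.1
      cases i with
      | zero =>
        have h4 := height_lt_weight (node l k b (some c) r)
        refine ⟨0, by simp, ?_⟩
        simp at h2
        omega
      | succ j =>
        obtain ⟨hl, hr⟩ := h.2.2 j rfl
        obtain ⟨p, hp1, hp2⟩ := ihl hl hc.2.1
        obtain ⟨q, hq1, hq2⟩ := ihr hr hc.2.2
        have hj : 0 < α ^ j := by positivity
        have hw : l.weight + r.weight < 8 * α * α ^ j := by
          have : (node l k b (some c) r).weight = l.weight + r.weight := rfl
          rw [pow_succ, mul_comm (α ^ j)] at h2
          rw [mul_assoc]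
          omega
        have key : ∀ x : ℕ, x * (2 * α ^ j - 1) ≤ l.weight + r.weight → x ≤ 8 * α := by
          intro x hx
          have h5 : x * α ^ j ≤ x * (2 * α ^ j - 1) := Nat.mul_le_mul_left _ (by omega)
          exact (lt_of_mul_lt_mul_right (h5.trans_lt (hx.trans_lt hw)) (Nat.zero_le _)).le
        have := key p (by omega)
        have := key q (by omega)
        -- A critical node ends the run: the `8 * α` secondary nodes below it and the node itself go
        -- into the term for this level.
        refine ⟨0, by simp, ?_⟩
        simp only [height]
        have : (8 * α + 1) * (j + 1) = (8 * α + 1) * j + (8 * α + 1) := by ring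
        omega

/-- Height and number of critical nodes on a path, in terms of the top level `i`. -/
lemma RootLeveled.bounds {t : LTree K} (hα : 2 ≤ α) (h : t.RootLeveled α) (hc : t.InfoCorrect)
    (hr : t.RootCritical) :
    ∃ i, 4 * α ^ i ≤ t.weight + 3 ∧ t.critDepth ≤ i + 3 ∧
      t.height ≤ 8 * α + 3 + (8 * α + 1) * i := by
  cases t with
  -- The empty tree, of weight `1`, is why the bound reads `+ 3`; nonempty trees satisfy it with `+
  -- 2`.
  | nil => exact ⟨0, by simp [weight], by simp [critDepth], by simp [height]⟩
  | node l k b info r =>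
    obtain ⟨i, h1, hl, hr'⟩ := h
    obtain ⟨c, rfl⟩ := Option.isSome_iff_exists.1 hr
    have h1 := h1 c rfl
    have h2 := hc.1 c rfl
    have hwl := hl.le_weight hα hc.2.1
    have hwr := hr'.le_weight hα hc.2.2
    obtain ⟨p, hp1, hp2⟩ := hl.height_le hα hc.2.1
    obtain ⟨q, hq1, hq2⟩ := hr'.height_le hα hc.2.2
    have hdl := hl.critDepth_le hc.2.1
    have hdr := hr'.critDepth_le hc.2.2
    have hj : 0 < α ^ i := by positivity
    have hw : l.weight + r.weight < 8 * α * α ^ i := by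
      have : (node l k b (some c) r).weight = l.weight + r.weight := rfl
      rw [pow_succ, mul_comm (α ^ i)] at h1
      rw [mul_assoc]
      omega
    have key : ∀ x : ℕ, x * (2 * α ^ i - 1) ≤ l.weight + r.weight → x ≤ 8 * α := by
      intro x hx
      have h5 : x * α ^ i ≤ x * (2 * α ^ i - 1) := Nat.mul_le_mul_left _ (by omega)
      exact (lt_of_mul_lt_mul_right (h5.trans_lt (hx.trans_lt hw)) (Nat.zero_le _)).le
    have := key p (by omega)
    have := key q (by omega)
    refine ⟨i, by simp only [weight]; omega, by simp only [critDepth]; simp; omega, ?_⟩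
    simp only [height]
    omega

end Bounds

end LTree

/-! ### The perfectly balanced construction. -/

section Build

variable {K : Type u}

/-- The recursion scheme of `build`: splitting at position `length / 2` leaves at most one more
entry on the left than on the right. -/
lemma balanced_induction {A : Type u} {P : List A → Prop} (nil : P [])
    (node : ∀ l e r, r.length ≤ l.length → l.length ≤ r.length + 1 → P l → P r →
      P (l ++ e :: r)) (a : List A) : P a := by
  induction hn : a.length using Nat.strong_induction_on generalizing a with
  | _ n ih =>
    cases h : a.drop (a.length / 2) with
    | nil =>
      have h1 := congrArg List.length h
      simp only [List.length_drop, List.length_nil] at h1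
      have h2 : a = [] := List.eq_nil_of_length_eq_zero (by omega)
      subst h2; exact nil
    | cons e r =>
      have h1 := congrArg List.length h
      simp only [List.length_drop, List.length_cons] at h1
      rw [← List.take_append_drop (a.length / 2) a, h]
      refine node _ _ _ ?_ ?_ (ih _ ?_ _ rfl) (ih _ ?_ _ rfl) <;>
        (try rw [List.length_take]) <;> omega

lemma build_nil (α : ℕ) (mark : Bool) :
    build α mark ([] : List (K × Bool)) = Counted.ret .nil := by
  rw [build]
  split
  · rfl
  · rename_i h; simp at h

open scoped Classical in
lemma build_node (α : ℕ) (mark : Bool) (l : List (K × Bool)) (e : K × Bool)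
    (r : List (K × Bool)) (h1 : r.length ≤ l.length) (h2 : l.length ≤ r.length + 1) :
    build α mark (l ++ e :: r) =
      Counted.charge 1 2
        ((build α (decide (IsCritical α (l.length + 1) (r.length + 1))) l).bind fun t =>
          (build α (decide (IsCritical α (r.length + 1) (l.length + 1))) r).bind fun t' =>
            Counted.ret (.node t e.1 e.2
              (freshInfo mark (l.length + 1 + (r.length + 1))) t')) := by
  have hm : (l ++ e :: r).length / 2 = l.length := by simp; omega
  have hd : (l ++ e :: r).drop ((l ++ e :: r).length / 2) = e :: r := by rw [hm]; simp
  have ht : (l ++ e :: r).take ((l ++ e :: r).length / 2) = l := by rw [hm]; simp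
  rw [build]
  split
  · rename_i h; rw [hd] at h; cases h
  · rename_i e' r' h
    rw [hd] at h
    obtain ⟨rfl, rfl⟩ := List.cons.inj h
    simp only [ht]

lemma build_entries (α : ℕ) (mark : Bool) (a : List (K × Bool)) :
    (build α mark a).val.entries = a := by
  induction a using balanced_induction generalizing mark with
  | nil => rw [build_nil]; rfl
  | node l e r h1 h2 ihl ihr => rw [build_node _ _ _ _ _ h1 h2]; simp [LTree.entries, ihl, ihr]

lemma build_weight (α : ℕ) (mark : Bool) (a : List (K × Bool)) :
    (build α mark a).val.weight = a.length + 1 := by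
  rw [LTree.weight_eq, build_entries]

lemma build_reads (α : ℕ) (mark : Bool) (a : List (K × Bool)) :
    (build α mark a).reads = a.length := by
  induction a using balanced_induction generalizing mark with
  | nil => rw [build_nil]; rfl
  | node l e r h1 h2 ihl ihr => rw [build_node _ _ _ _ _ h1 h2]; simp [ihl, ihr]; omega

lemma build_writes (α : ℕ) (mark : Bool) (a : List (K × Bool)) :
    (build α mark a).writes = 2 * a.length := by
  induction a using balanced_induction generalizing mark with
  | nil => rw [build_nil]; rfl
  | node l e r h1 h2 ihl ihr => rw [build_node _ _ _ _ _ h1 h2]; simp [ihl, ihr]; omega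

lemma build_infoCorrect (α : ℕ) (mark : Bool) (a : List (K × Bool)) :
    (build α mark a).val.InfoCorrect := by
  induction a using balanced_induction generalizing mark with
  | nil => rw [build_nil]; trivial
  | node l e r h1 h2 ihl ihr =>
    rw [build_node _ _ _ _ _ h1 h2]
    refine ⟨?_, ihl _, ihr _⟩
    intro c hc
    simp only [LTree.weight, build_weight]
    cases mark
    · simp [freshInfo] at hc
    · simp only [freshInfo, if_true, Option.mem_def, Option.some.injEq] at hc
      subst hc
      simp

lemma build_potential (α : ℕ) (mark : Bool) (a : List (K × Bool)) :
    (build α mark a).val.potential = 0 := by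
  induction a using balanced_induction generalizing mark with
  | nil => rw [build_nil]; rfl
  | node l e r h1 h2 ihl ihr =>
    rw [build_node _ _ _ _ _ h1 h2]
    cases mark <;> simp [LTree.potential, ihl, ihr, freshInfo]

lemma build_rootCritical (α : ℕ) (a : List (K × Bool)) :
    (build α true a).val.RootCritical := by
  induction a using balanced_induction with
  | nil => rw [build_nil]; trivial
  | node l e r h1 h2 ihl ihr =>
    rw [build_node _ _ _ _ _ h1 h2]
    rfl

end Build

/-! ### Levels of freshly constructed and reconstructed trees. -/

/-- The weight condition under which a freshly constructed tree with a marked (or unmarked) root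
has level `i`. -/
def FitsLevel (α i : ℕ) (mark : Bool) (w : ℕ) : Prop :=
  if mark then 2 * α ^ i ≤ w + 1 ∧ w + 2 ≤ 4 * α ^ i
  else 4 * α ^ i ≤ w + 1 ∧ w + 2 ≤ 4 * α ^ (i + 1)

lemma two_mul_pow_le {α i j : ℕ} (hα : 2 ≤ α) (h : i < j) : 2 * α ^ i ≤ α ^ j := by
  calc 2 * α ^ i ≤ α * α ^ i := Nat.mul_le_mul_right _ hα
    _ = α ^ (i + 1) := by ring
    _ ≤ α ^ j := Nat.pow_le_pow_right (by omega) h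

-- The halves have weight at least `2α^i - 1`. Equality forces the sibling to be `2α^i`, which is
-- critical; rule (2) makes both halves critical together. A half too heavy for level `i` is at most
-- `2α^(i+1) - 1`, and if it attains this value so does its sibling at most, so rule (2) cannot fire
-- one level too early.
open scoped Classical in
lemma fitsLevel_half {α i c d : ℕ} (hα : 2 ≤ α) (hcd : c ≤ d + 1) (hdc : d ≤ c + 1)
    (h1 : 4 * α ^ i ≤ c + d + 1) (h2 : c + d + 2 ≤ 4 * α ^ (i + 1)) :
    FitsLevel α i (decide (IsCritical α c d)) c := by
  have hp : 0 < α ^ i := by positivity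
  have hlt : ∀ j, j < i → 2 * α ^ j ≤ α ^ i := fun j => two_mul_pow_le hα
  have hgt : ∀ j, i + 1 ≤ j → α ^ (i + 1) ≤ α ^ j := fun j => Nat.pow_le_pow_right (by omega)
  unfold FitsLevel
  by_cases h : IsCritical α c d
  · simp only [h, decide_true, if_true]
    obtain ⟨j, hj⟩ := h
    -- Only level `i` is possible: the intervals of lower levels end below `c`, those of higher
    -- levels start above it.
    rcases lt_trichotomy j i with hji | rfl | hij
    · have := hlt j hji; omega
    · omega
    · have := hgt j hij; omega
  · simp only [h, decide_false]
    have h3 : ¬ _ := fun hh => h ⟨i, hh⟩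
    simp
    omega

/-- A secondary root passes its level on to both halves. Below a critical root of level `j + 1`, the
inequality `4α^j ≤ 2α^(j+1)` puts the halves in the range of `fitsLevel_half` at level `j`. -/
lemma build_leveled {K : Type u} {α i : ℕ} (hα : 2 ≤ α) (mark : Bool) (a : List (K × Bool))
    (h : FitsLevel α i mark (a.length + 1)) : (build α mark a).val.Leveled α i := by
  induction a using balanced_induction generalizing mark i with
  | nil =>
    rw [build_nil]
    have hp : 0 < α ^ i := by positivity
    cases mark
    · simp [FitsLevel] at h; omega
    · simp [FitsLevel] at h
      by_contra hi
      have := two_mul_pow_le hα (Nat.pos_of_ne_zero hi)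
      simp at this
      omega
  | node l e r h1 h2 ihl ihr =>
    rw [build_node _ _ _ _ _ h1 h2]
    simp only [List.length_append, List.length_cons] at h
    cases mark with
    | false =>
      simp only [FitsLevel, Bool.false_eq_true, if_false] at h
      exact ⟨ihl _ (fitsLevel_half hα (by omega) (by omega) (by omega) (by omega)),
        ihr _ (fitsLevel_half hα (by omega) (by omega) (by omega) (by omega))⟩
    | true =>
      simp only [FitsLevel, if_true] at h
      refine ⟨by simp; omega, by simp; omega, ?_⟩
      rintro j rfl
      have := two_mul_pow_le hα (Nat.lt_add_one j)
      exact ⟨ihl _ (fitsLevel_half hα (by omega) (by omega) (by omega) (by omega)),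
        ihr _ (fitsLevel_half hα (by omega) (by omega) (by omega) (by omega))⟩

lemma build_rootLeveled {K : Type u} {α : ℕ} (hα : 2 ≤ α) (a : List (K × Bool)) :
    (build α true a).val.RootLeveled α := by
  induction a using balanced_induction with
  | nil => rw [build_nil]; trivial
  | node l e r h1 h2 _ _ =>
    rw [build_node _ _ _ _ _ h1 h2]
    -- A single node is treated apart: `n` below would be `0`, and `α ^ Nat.log α n ≤ n` would fail.
    by_cases hl : l.length = 0
    · have hr : r.length = 0 := by omega
      rw [List.eq_nil_of_length_eq_zero hl, List.eq_nil_of_length_eq_zero hr]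
      refine ⟨0, ?_, ?_, ?_⟩
      · simp [freshInfo]; omega
      · simp [build_nil, LTree.Leveled]
      · simp [build_nil, LTree.Leveled]
    -- With `w` the weight of the whole tree, `n` is `(w + 1) / 4` rounded down, so that `α^i ≤ n <
    -- α^(i+1)` is exactly the range `4α^i ≤ w + 1`, `w + 2 ≤ 4α^(i+1)` of `fitsLevel_half`.
    · set n := (l.length + r.length + 3) / 4 with hn
      have h3 : α ^ Nat.log α n ≤ n := Nat.pow_log_le_self α (by omega)
      have h4 : n < α ^ (Nat.log α n + 1) := Nat.lt_pow_succ_log_self (by omega) n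
      refine ⟨Nat.log α n, ?_, ?_, ?_⟩
      · simp [freshInfo]; omega
      · exact build_leveled hα _ _
          (fitsLevel_half hα (by omega) (by omega) (by omega) (by omega))
      · exact build_leveled hα _ _
          (fitsLevel_half hα (by omega) (by omega) (by omega) (by omega))

-- If `2s` still fits level `i`, the root is marked and keeps that level. Otherwise the root must be
-- secondary, so that the halves take over level `i`; the exception in `IsCriticalAfterRebuild`
-- suppresses precisely a root that would be of level `i + 1`.
open scoped Classical in
lemma fitsLevel_rebuild {α i s : ℕ} (hα : 2 ≤ α) (h1 : 2 * α ^ i ≤ s + 1)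
    (h2 : s + 2 ≤ 4 * α ^ i) :
    FitsLevel α i (decide (IsCriticalAfterRebuild α s (2 * s))) (2 * s) := by
  have hp : 0 < α ^ i := by positivity
  have hlt : ∀ j, j < i → 2 * α ^ j ≤ α ^ i := fun j => two_mul_pow_le hα
  have hgt : ∀ j, i + 1 ≤ j → α ^ (i + 1) ≤ α ^ j := fun j => Nat.pow_le_pow_right (by omega)
  have hs := two_mul_pow_le hα (Nat.lt_add_one i)
  unfold FitsLevel
  by_cases h : IsCriticalAfterRebuild α s (2 * s)
  · simp only [h, decide_true, if_true]
    obtain ⟨⟨j, hj⟩, hex⟩ := h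
    have hex' : ¬ _ := fun hh => hex ⟨i, hh⟩
    rcases lt_trichotomy j i with hji | rfl | hij
    · have := hlt j hji; omega
    · omega
    · have := hgt j hij; omega
  · simp only [h, decide_false, Bool.false_eq_true, if_false]
    refine ⟨?_, by omega⟩
    by_contra hlt'
    refine h ⟨⟨i, by omega, by omega⟩, ?_⟩
    rintro ⟨j, hj⟩
    rcases lt_or_ge j i with hji | hij
    · have := hlt j hji; omega
    · have := hgt (j + 1) (by omega); omega

section General

variable {K : Type u}

/-! ### Effect and cost of reconstructions. -/

section Reconstruction

lemma flatten_val (t : LTree K) (acc : List (K × Bool)) :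
    (flatten t acc).val = t.entries ++ acc := by
  induction t generalizing acc with
  | nil => rfl
  | node l k b info r ihl ihr => simp [flatten, LTree.entries, ihl, ihr]

lemma flatten_reads (t : LTree K) (acc : List (K × Bool)) :
    (flatten t acc).reads = t.entries.length := by
  induction t generalizing acc with
  | nil => rfl
  | node l k b info r ihl ihr => simp [flatten, LTree.entries, ihl, ihr]; omega

lemma flatten_writes (t : LTree K) (acc : List (K × Bool)) :
    (flatten t acc).writes = 2 * t.entries.length := by
  induction t generalizing acc with
  | nil => rfl
  | node l k b info r ihl ihr => simp [flatten, LTree.entries, ihl, ihr]; omega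

lemma rebuildSubtree_entries (α s : ℕ) (t : LTree K) :
    (rebuildSubtree α s t).val.entries = t.entries := by
  simp [rebuildSubtree, build_entries, flatten_val]

lemma rebuildSubtree_reads (α s : ℕ) (t : LTree K) :
    (rebuildSubtree α s t).reads = 2 * t.entries.length := by
  simp [rebuildSubtree, build_reads, flatten_val, flatten_reads]; omega

lemma rebuildSubtree_writes (α s : ℕ) (t : LTree K) :
    (rebuildSubtree α s t).writes = 4 * t.entries.length + 1 := by
  simp [rebuildSubtree, build_writes, flatten_val, flatten_writes]; omega

lemma rebuildSubtree_potential (α s : ℕ) (t : LTree K) :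
    (rebuildSubtree α s t).val.potential = 0 := by
  simp [rebuildSubtree, build_potential]

lemma rebuildSubtree_infoCorrect (α s : ℕ) (t : LTree K) :
    (rebuildSubtree α s t).val.InfoCorrect :=
  build_infoCorrect _ _ _

lemma rebuildSubtree_leveled {α i s : ℕ} (hα : 2 ≤ α) (t : LTree K) (hw : t.weight = 2 * s)
    (h1 : 2 * α ^ i ≤ s + 1) (h2 : s + 2 ≤ 4 * α ^ i) :
    (rebuildSubtree α s t).val.Leveled α i := by
  apply build_leveled hα
  have hlen : (flatten t []).val.length + 1 = 2 * s := by
    rw [← hw, LTree.weight_eq, flatten_val, List.append_nil]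
  rw [hlen]
  exact fitsLevel_rebuild hα h1 h2

lemma rebuildAll_reads_le (α : ℕ) (t : LTree K) :
    (rebuildAll α t).reads ≤ 3 * t.entries.length := by
  have := List.length_filter_le Prod.snd t.entries
  simp [rebuildAll, build_reads, flatten_val, flatten_reads]
  omega

lemma rebuildAll_writes_le (α : ℕ) (t : LTree K) :
    (rebuildAll α t).writes ≤ 5 * t.entries.length + 1 := by
  have := List.length_filter_le Prod.snd t.entries
  simp [rebuildAll, build_writes, flatten_val, flatten_writes]
  omega

lemma rebuildAll_potential (α : ℕ) (t : LTree K) : (rebuildAll α t).val.potential = 0 := by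
  simp [rebuildAll, build_potential]

lemma rootInfo_weight {t : LTree K} (hc : t.InfoCorrect) (hr : t.RootCritical) :
    (rootInfo t).weight = t.weight := by
  cases t with
  | nil => rfl
  | node l x b info r =>
    obtain ⟨c, rfl⟩ := Option.isSome_iff_exists.1 hr
    exact (hc.1 c rfl).1

end Reconstruction

/-! ### Operations along a search path. -/

section Paths

variable [LinearOrder K]

namespace LTree

/-- The search tree property. -/
def Sorted (t : LTree K) : Prop := (t.entries.map Prod.fst).Pairwise (· < ·)

lemma sorted_node {l r : LTree K} {x : K} {b : Bool} {info : Option BalanceInfo} :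
    (node l x b info r).Sorted ↔ l.Sorted ∧ r.Sorted ∧ (∀ e ∈ l.entries, e.1 < x) ∧
      ∀ e ∈ r.entries, x < e.1 := by
  simp only [Sorted, entries, List.map_append, List.map_cons, List.pairwise_append,
    List.pairwise_cons, List.mem_map, List.mem_cons]
  constructor
  · rintro ⟨h1, ⟨h2, h3⟩, h4⟩
    exact ⟨h1, h3, fun e he => h4 _ ⟨e, he, rfl⟩ _ (Or.inl rfl), fun e he => h2 _ ⟨e, he, rfl⟩⟩
  · rintro ⟨h1, h2, h3, h4⟩
    refine ⟨h1, ⟨?_, h2⟩, ?_⟩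
    · rintro _ ⟨e, he, rfl⟩; exact h4 e he
    · rintro _ ⟨e, he, rfl⟩ y (rfl | ⟨e', he', rfl⟩)
      · exact h3 e he
      · exact (h3 e he).trans (h4 e' he')

end LTree

open LTree

lemma mem_of_search_eq_some {k : K} {b : Bool} {t : LTree K}
    (h : (search k t).val = some b) : (k, b) ∈ t.entries := by
  induction t with
  | nil => simp [search] at h
  | node l x b' info r ihl ihr =>
    simp only [search, Counted.charge_val] at h
    simp only [entries, List.mem_append, List.mem_cons]
    split_ifs at h with h1 h2
    · exact Or.inl (ihl h)
    · exact Or.inr (Or.inr (ihr h))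
    · have : k = x := le_antisymm (not_lt.1 h2) (not_lt.1 h1)
      simp at h
      simp [this, h]

lemma ne_of_search_eq_none {k : K} {t : LTree K} (ht : t.Sorted)
    (h : (search k t).val = none) : ∀ e ∈ t.entries, e.1 ≠ k := by
  induction t with
  | nil => simp [entries]
  | node l x b' info r ihl ihr =>
    obtain ⟨hl, hr, hlx, hrx⟩ := sorted_node.1 ht
    simp only [search, Counted.charge_val] at h
    simp only [entries, List.mem_append, List.mem_cons]
    rintro e (he | rfl | he) <;> split_ifs at h with h1 h2
    · exact ihl hl h e he
    · exact ((hlx e he).trans h2).ne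
    · cases h
    · exact h1.ne'
    · exact h2.ne
    · cases h
    · exact (h1.trans (hrx e he)).ne'
    · exact ihr hr h e he
    · cases h

lemma search_reads_le (k : K) (t : LTree K) : (search k t).reads ≤ t.height + 1 := by
  induction t with
  | nil => simp [search]
  | node l x b info r ihl ihr =>
    simp only [search, Counted.charge_reads, height]
    split_ifs
    · omega
    · omega
    · simp

lemma search_writes (k : K) (t : LTree K) : (search k t).writes = 0 := by
  induction t with
  | nil => simp [search]
  | node l x b info r ihl ihr =>
    simp only [search, Counted.charge_writes]
    split_ifs
    · omega
    · omega
    · simp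

/-- Setting the flag of a key changes exactly one entry. -/
lemma setLive_entries {k : K} {b v : Bool} {t : LTree K} (ht : t.Sorted)
    (h : (k, b) ∈ t.entries) :
    ∃ p q, t.entries = p ++ (k, b) :: q ∧ (setLive k v t).val.entries = p ++ (k, v) :: q := by
  induction t with
  | nil => simp [entries] at h
  | node l x b' info r ihl ihr =>
    obtain ⟨hl, hr, hlx, hrx⟩ := sorted_node.1 ht
    simp only [entries, List.mem_append, List.mem_cons] at h
    simp only [setLive, Counted.charge_val]
    rcases h with h | h | h
    · obtain ⟨p, q, h1, h2⟩ := ihl hl h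
      have hk : k < x := hlx _ h
      exact ⟨p, q ++ (x, b') :: r.entries, by simp [entries, h1], by simp [entries, h2, hk]⟩
    · obtain ⟨rfl, rfl⟩ := Prod.mk.inj h
      exact ⟨l.entries, r.entries, by simp [entries], by simp [entries]⟩
    · obtain ⟨p, q, h1, h2⟩ := ihr hr h
      have hk : x < k := hrx _ h
      exact ⟨l.entries ++ (x, b') :: p, q, by simp [entries, h1],
        by simp [entries, h2, hk, hk.not_gt]⟩

lemma setLive_reads_le (k : K) (v : Bool) (t : LTree K) :
    (setLive k v t).reads ≤ t.height + 1 := by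
  induction t with
  | nil => simp [setLive]
  | node l x b info r ihl ihr =>
    simp only [setLive, Counted.charge_reads, height]
    split_ifs <;> simp <;> omega

lemma setLive_writes_le (k : K) (v : Bool) (t : LTree K) : (setLive k v t).writes ≤ 1 := by
  induction t with
  | nil => simp [setLive]
  | node l x b info r ihl ihr =>
    simp only [setLive, Counted.charge_writes]
    split_ifs <;> simp <;> omega

lemma setLive_weight (k : K) (v : Bool) (t : LTree K) :
    (setLive k v t).val.weight = t.weight := by
  induction t with
  | nil => simp [setLive]
  | node l x b info r ihl ihr =>
    simp only [setLive, Counted.charge_val]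
    split_ifs <;> simp [weight, ihl, ihr]

lemma setLive_potential (k : K) (v : Bool) (t : LTree K) :
    (setLive k v t).val.potential = t.potential := by
  induction t with
  | nil => simp [setLive]
  | node l x b info r ihl ihr =>
    simp only [setLive, Counted.charge_val]
    split_ifs <;> simp [potential, ihl, ihr]

lemma setLive_infoCorrect {k : K} (v : Bool) {t : LTree K} (h : t.InfoCorrect) :
    (setLive k v t).val.InfoCorrect := by
  induction t with
  | nil => simpa [setLive] using h
  | node l x b info r ihl ihr =>
    obtain ⟨h1, h2, h3⟩ := h
    simp only [setLive, Counted.charge_val]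
    split_ifs
    · exact ⟨by simpa [weight, setLive_weight] using h1, ihl h2, h3⟩
    · exact ⟨by simpa [weight, setLive_weight] using h1, h2, ihr h3⟩
    · exact ⟨h1, h2, h3⟩

lemma setLive_leveled {α i : ℕ} {k : K} (v : Bool) {t : LTree K} (h : t.Leveled α i) :
    (setLive k v t).val.Leveled α i := by
  induction t generalizing i with
  | nil => simpa [setLive] using h
  | node l x b info r ihl ihr =>
    simp only [setLive, Counted.charge_val]
    cases info with
    | none =>
      split_ifs
      · exact ⟨ihl h.1, h.2⟩
      · exact ⟨h.1, ihr h.2⟩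
      · exact h
    | some c =>
      obtain ⟨h1, h2, h3⟩ := h
      split_ifs
      · exact ⟨h1, h2, fun j hj => ⟨ihl (h3 j hj).1, (h3 j hj).2⟩⟩
      · exact ⟨h1, h2, fun j hj => ⟨(h3 j hj).1, ihr (h3 j hj).2⟩⟩
      · exact ⟨h1, h2, h3⟩

lemma setLive_rootLeveled {α : ℕ} {k : K} (v : Bool) {t : LTree K} (h : t.RootLeveled α) :
    (setLive k v t).val.RootLeveled α := by
  cases t with
  | nil => simpa [setLive] using h
  | node l x b info r =>
    obtain ⟨i, h1, h2, h3⟩ := h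
    simp only [setLive, Counted.charge_val]
    split_ifs
    · exact ⟨i, h1, setLive_leveled v h2, h3⟩
    · exact ⟨i, h1, h2, setLive_leveled v h3⟩
    · exact ⟨i, h1, h2, h3⟩

lemma setLive_rootCritical {k : K} (v : Bool) {t : LTree K} (h : t.RootCritical) :
    (setLive k v t).val.RootCritical := by
  cases t with
  | nil => simpa [setLive] using h
  | node l x b info r =>
    simp only [setLive, Counted.charge_val]
    split_ifs <;> exact h

/-- Attaching a leaf inserts one entry at its place in the order. -/
lemma attach_entries {k : K} {t : LTree K} (ht : t.Sorted) (h : ∀ e ∈ t.entries, e.1 ≠ k) :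
    ∃ p q, t.entries = p ++ q ∧ (attach k t).val.entries = p ++ (k, true) :: q ∧
      (∀ e ∈ p, e.1 < k) ∧ ∀ e ∈ q, k < e.1 := by
  induction t with
  | nil => exact ⟨[], [], by simp [entries, attach]⟩
  | node l x b info r ihl ihr =>
    obtain ⟨hl, hr, hlx, hrx⟩ := sorted_node.1 ht
    simp only [entries, List.mem_append, List.mem_cons] at h
    have hx : x ≠ k := h (x, b) (Or.inr (Or.inl rfl))
    simp only [attach, Counted.charge_val]
    by_cases hk : k < x
    · obtain ⟨p, q, h1, h2, h3, h4⟩ := ihl hl fun e he => h e (Or.inl he)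
      refine ⟨p, q ++ (x, b) :: r.entries, by simp [entries, h1],
        by simp [entries, h2, hk], h3, ?_⟩
      simp only [List.mem_append, List.mem_cons]
      rintro e (he | rfl | he)
      · exact h4 e he
      · exact hk
      · exact hk.trans (hrx e he)
    · have hk' : x < k := lt_of_le_of_ne (not_lt.1 hk) hx
      obtain ⟨p, q, h1, h2, h3, h4⟩ := ihr hr fun e he => h e (Or.inr (Or.inr he))
      refine ⟨l.entries ++ (x, b) :: p, q, by simp [entries, h1],
        by simp [entries, h2, hk], ?_, h4⟩
      simp only [List.mem_append, List.mem_cons]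
      rintro e (he | rfl | he)
      · exact (hlx e he).trans hk'
      · exact hk'
      · exact h3 e he

lemma attach_weight (k : K) (t : LTree K) : (attach k t).val.weight = t.weight + 1 := by
  induction t with
  | nil => simp [attach, weight]
  | node l x b info r ihl ihr =>
    simp only [attach, Counted.charge_val]
    split_ifs <;> simp [weight, ihl, ihr] <;> omega

lemma attach_reads_le (k : K) (t : LTree K) : (attach k t).reads ≤ t.height + 1 := by
  induction t with
  | nil => simp [attach]
  | node l x b info r ihl ihr =>
    simp only [attach, Counted.charge_reads, height]
    split_ifs <;> simp <;> omega

lemma attach_writes_le (k : K) (t : LTree K) : (attach k t).writes ≤ t.critDepth + 2 := by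
  induction t with
  | nil => simp [attach]
  | node l x b info r ihl ihr =>
    simp only [attach, Counted.charge_writes, critDepth]
    split_ifs <;> simp <;> omega

lemma rebalance_entries (α : ℕ) (k : K) (t : LTree K) :
    (rebalance α k t).val.entries = t.entries := by
  induction t with
  | nil => rfl
  | node l x b info r ihl ihr =>
    simp only [rebalance, Counted.charge_val]
    split
    · split_ifs <;> simp [entries, ihl, ihr]
    · split_ifs <;> simp [entries, ihl, ihr, rebuildSubtree_entries]

lemma rebalance_weight (α : ℕ) (k : K) (t : LTree K) :
    (rebalance α k t).val.weight = t.weight := by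
  rw [weight_eq, weight_eq, rebalance_entries]

/-- Attaching a leaf and rebalancing below restores the balancing information, and the cost is paid
by the decrease of the potential. -/
lemma rebalance_attach {α : ℕ} {k : K} {t : LTree K} (h : ∀ e ∈ t.entries, e.1 ≠ k)
    (hc : t.InfoCorrect) :
    (rebalance α k (attach k t).val).val.InfoCorrect ∧
    (rebalance α k (attach k t).val).reads +
        12 * (rebalance α k (attach k t).val).val.potential ≤
      12 * t.potential + 12 * t.critDepth + t.height + 1 ∧
    (rebalance α k (attach k t).val).writes +
        12 * (rebalance α k (attach k t).val).val.potential ≤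
      12 * t.potential + 12 * t.critDepth := by
  induction t with
  | nil => simp [attach, rebalance, Overflows, InfoCorrect, weight, potential]
  | node l x b info r ihl ihr =>
    obtain ⟨hc1, hc2, hc3⟩ := hc
    simp only [entries, List.mem_append, List.mem_cons] at h
    have hx : x ≠ k := h (x, b) (Or.inr (Or.inl rfl))
    obtain ⟨il, rl, wl⟩ := ihl (fun e he => h e (Or.inl he)) hc2
    obtain ⟨ir, rr, wr⟩ := ihr (fun e he => h e (Or.inr (Or.inr he))) hc3
    simp only [attach, Counted.charge_val]
    cases info with
    | none =>
      rcases lt_or_gt_of_ne hx with hk | hk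
      · simp only [hk, hk.not_gt, if_true, if_false, Counted.bind_val, Counted.ret_val,
          Option.map_none, rebalance, Counted.charge_val, Counted.charge_reads,
          Counted.charge_writes, Counted.bind_reads, Counted.bind_writes, Counted.ret_reads,
          Counted.ret_writes, InfoCorrect, potential, height, critDepth, Option.elim_none]
        refine ⟨⟨by simp, hc2, ir⟩, ?_, ?_⟩ <;> omega
      · simp only [hk, hk.not_gt, if_true, if_false, Counted.bind_val, Counted.ret_val,
          Option.map_none, rebalance, Counted.charge_val, Counted.charge_reads,
          Counted.charge_writes, Counted.bind_reads, Counted.bind_writes, Counted.ret_reads,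
          Counted.ret_writes, InfoCorrect, potential, height, critDepth, Option.elim_none]
        refine ⟨⟨by simp, il, hc3⟩, ?_, ?_⟩ <;> omega
    | some c =>
      have hw := hc1 c rfl
      simp only [weight] at hw
      have hwa := attach_weight k l
      have hwa' := attach_weight k r
      by_cases ho : Overflows ⟨c.initial, c.weight + 1⟩
      -- Before the insertion this node held at least `initial - 1` units of potential; with the
      -- unit allowed by `critDepth`, `12 * initial` is six per unit of the new weight, enough for
      -- four writes per node and the pointer.
      · have ho' : 2 * c.initial ≤ c.weight + 1 := ho
        rcases lt_or_gt_of_ne hx with hk | hk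
        · simp only [hk.not_gt, if_false, Counted.bind_val, Counted.ret_val, Option.map_some,
            rebalance, Counted.charge_val, Counted.charge_reads, Counted.charge_writes, ho, if_true,
            rebuildSubtree_reads, rebuildSubtree_writes, rebuildSubtree_potential, potential,
            height, critDepth, Option.elim_some, Option.isSome_some]
          refine ⟨rebuildSubtree_infoCorrect _ _ _, ?_, ?_⟩ <;>
          · have := weight_eq (node l x b (some ⟨c.initial, c.weight + 1⟩) (attach k r).val)
            simp only [weight] at this
            omega
        · simp only [hk, Counted.bind_val, Counted.ret_val, Option.map_some,
            rebalance, Counted.charge_val, Counted.charge_reads, Counted.charge_writes, ho, if_true,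
            rebuildSubtree_reads, rebuildSubtree_writes, rebuildSubtree_potential, potential,
            height, critDepth, Option.elim_some, Option.isSome_some]
          refine ⟨rebuildSubtree_infoCorrect _ _ _, ?_, ?_⟩ <;>
          · have := weight_eq (node (attach k l).val x b (some ⟨c.initial, c.weight + 1⟩) r)
            simp only [weight] at this
            omega
      · have ho' : ¬ 2 * c.initial ≤ c.weight + 1 := ho
        have hre := rebalance_weight α k (attach k l).val
        have hre' := rebalance_weight α k (attach k r).val
        rcases lt_or_gt_of_ne hx with hk | hk
        · simp only [hk, hk.not_gt, if_true, if_false, Counted.bind_val, Counted.ret_val,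
            Option.map_some, rebalance, Counted.charge_val, Counted.charge_reads,
            Counted.charge_writes, Counted.bind_reads, Counted.bind_writes, Counted.ret_reads,
            Counted.ret_writes, InfoCorrect, potential, height, critDepth, ho,
            Option.elim_some, Option.isSome_some, Option.mem_def, Option.some.injEq,
            forall_eq', weight]
          refine ⟨⟨by omega, hc2, ir⟩, ?_, ?_⟩ <;> omega
        · simp only [hk, hk.not_gt, if_true, if_false, Counted.bind_val, Counted.ret_val,
            Option.map_some, rebalance, Counted.charge_val, Counted.charge_reads,
            Counted.charge_writes, Counted.bind_reads, Counted.bind_writes, Counted.ret_reads,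
            Counted.ret_writes, InfoCorrect, potential, height, critDepth, ho,
            Option.elim_some, Option.isSome_some, Option.mem_def, Option.some.injEq,
            forall_eq', weight]
          refine ⟨⟨by omega, il, hc3⟩, ?_, ?_⟩ <;> omega

/-- Initial weights, hence levels, change only in the reconstructed subtree, whose level is
preserved. A new leaf, with initial weight `2`, has level `0` like the empty tree it replaces. -/
lemma rebalance_attach_leveled {α : ℕ} (hα : 2 ≤ α) {k : K} {t : LTree K} {i : ℕ}
    (h : ∀ e ∈ t.entries, e.1 ≠ k) (hc : t.InfoCorrect) (ht : t.Leveled α i) :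
    (rebalance α k (attach k t).val).val.Leveled α i := by
  induction t generalizing i with
  | nil =>
    simp only [Leveled] at ht
    subst ht
    simp [attach, rebalance, Overflows, Leveled]
  | node l x b info r ihl ihr =>
    obtain ⟨hc1, hc2, hc3⟩ := hc
    simp only [entries, List.mem_append, List.mem_cons] at h
    have hx : x ≠ k := h (x, b) (Or.inr (Or.inl rfl))
    replace ihl := fun j => ihl (i := j) (fun e he => h e (Or.inl he)) hc2
    replace ihr := fun j => ihr (i := j) (fun e he => h e (Or.inr (Or.inr he))) hc3
    simp only [attach, Counted.charge_val]
    cases info with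
    | none =>
      rcases lt_or_gt_of_ne hx with hk | hk
      · simp only [hk, hk.not_gt, if_true, if_false, Counted.bind_val, Counted.ret_val,
          Option.map_none, rebalance, Counted.charge_val]
        exact ⟨ht.1, ihr i ht.2⟩
      · simp only [hk, if_true, Counted.bind_val, Counted.ret_val,
          Option.map_none, rebalance, Counted.charge_val]
        exact ⟨ihl i ht.1, ht.2⟩
    | some c =>
      have hw := hc1 c rfl
      simp only [weight] at hw
      have hwa := attach_weight k l
      have hwa' := attach_weight k r
      obtain ⟨h1, h2, h3⟩ := ht
      by_cases ho : Overflows ⟨c.initial, c.weight + 1⟩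
      · have ho' : 2 * c.initial ≤ c.weight + 1 := ho
        rcases lt_or_gt_of_ne hx with hk | hk
        · simp only [hk.not_gt, if_false, Counted.bind_val, Counted.ret_val, Option.map_some,
            rebalance, Counted.charge_val, ho, if_true]
          -- The weight was below `2 * initial` before the insertion, so an overflowing node has
          -- weight exactly `2 * initial`.
          exact rebuildSubtree_leveled hα _ (by simp only [weight]; omega) h1 h2
        · simp only [hk, Counted.bind_val, Counted.ret_val, Option.map_some,
            rebalance, Counted.charge_val, ho, if_true]
          exact rebuildSubtree_leveled hα _ (by simp only [weight]; omega) h1 h2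
      · rcases lt_or_gt_of_ne hx with hk | hk
        · simp only [hk, hk.not_gt, if_true, if_false, Counted.bind_val, Counted.ret_val,
            Option.map_some, rebalance, Counted.charge_val, ho]
          exact ⟨h1, h2, fun j hj => ⟨(h3 j hj).1, ihr j (h3 j hj).2⟩⟩
        · simp only [hk, if_true, if_false, Counted.bind_val, Counted.ret_val,
            Option.map_some, rebalance, Counted.charge_val, ho]
          exact ⟨h1, h2, fun j hj => ⟨ihl j (h3 j hj).1, (h3 j hj).2⟩⟩

lemma rebalanceBelowRoot_entries (α : ℕ) (k : K) (t : LTree K) :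
    (rebalanceBelowRoot α k t).val.entries = t.entries := by
  cases t with
  | nil => rfl
  | node l x b info r =>
    simp only [rebalanceBelowRoot, Counted.charge_val]
    split_ifs <;> simp [entries, rebalance_entries]

lemma rebalanceBelowRoot_attach {α : ℕ} (hα : 2 ≤ α) {k : K} {t : LTree K}
    (h : ∀ e ∈ t.entries, e.1 ≠ k) (hc : t.InfoCorrect) (ht : t.RootLeveled α)
    (hr : t.RootCritical) (ho : ¬ Overflows (rootInfo (attach k t).val)) :
    (rebalanceBelowRoot α k (attach k t).val).val.InfoCorrect ∧
    (rebalanceBelowRoot α k (attach k t).val).val.RootLeveled α ∧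
    (rebalanceBelowRoot α k (attach k t).val).val.RootCritical ∧
    (rebalanceBelowRoot α k (attach k t).val).reads +
        12 * (rebalanceBelowRoot α k (attach k t).val).val.potential ≤
      12 * t.potential + 12 * t.critDepth + t.height + 1 ∧
    (rebalanceBelowRoot α k (attach k t).val).writes +
        12 * (rebalanceBelowRoot α k (attach k t).val).val.potential ≤
      12 * t.potential + 12 * t.critDepth := by
  cases t with
  | nil =>
    have hp : 0 < α := by omega
    have hl : (nil : LTree K).Leveled α 0 := rfl
    simp [attach, rebalanceBelowRoot, InfoCorrect, weight, potential, RootLeveled,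
      RootCritical]
    exact ⟨0, by simp; omega, hl⟩
  | node l x b info r =>
    obtain ⟨hc1, hc2, hc3⟩ := hc
    obtain ⟨c, rfl⟩ := Option.isSome_iff_exists.1 hr
    obtain ⟨i, hi, hl, hr'⟩ := ht
    simp only [entries, List.mem_append, List.mem_cons] at h
    have hx : x ≠ k := h (x, b) (Or.inr (Or.inl rfl))
    have hnl : ∀ e ∈ l.entries, e.1 ≠ k := fun e he => h e (Or.inl he)
    have hnr : ∀ e ∈ r.entries, e.1 ≠ k := fun e he => h e (Or.inr (Or.inr he))
    have hw := hc1 c rfl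
    simp only [weight] at hw
    have hwa := attach_weight k l
    have hwa' := attach_weight k r
    have hre := rebalance_weight α k (attach k l).val
    have hre' := rebalance_weight α k (attach k r).val
    obtain ⟨il, rl, wl⟩ := rebalance_attach (α := α) hnl hc2
    obtain ⟨ir, rr, wr⟩ := rebalance_attach (α := α) hnr hc3
    have ho' : ¬ 2 * c.initial ≤ c.weight + 1 := by
      simp only [attach, Counted.charge_val] at ho
      split_ifs at ho <;> exact ho
    rcases lt_or_gt_of_ne hx with hk | hk
    · simp only [attach, hk, hk.not_gt, if_true, if_false, Counted.bind_val, Counted.ret_val,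
        Option.map_some, rebalanceBelowRoot, Counted.charge_val, Counted.charge_reads,
        Counted.charge_writes, Counted.bind_reads, Counted.bind_writes, Counted.ret_reads,
        Counted.ret_writes, InfoCorrect, potential, height, critDepth,
        Option.elim_some, Option.isSome_some, Option.mem_def, Option.some.injEq,
        forall_eq', weight]
      refine ⟨⟨by omega, hc2, ir⟩,
        ⟨i, by simpa using hi, hl, rebalance_attach_leveled hα hnr hc3 hr'⟩, rfl, ?_, ?_⟩ <;> omega
    · simp only [attach, hk, if_true, Counted.bind_val, Counted.ret_val,
        Option.map_some, rebalanceBelowRoot, Counted.charge_val, Counted.charge_reads,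
        Counted.charge_writes, Counted.bind_reads, Counted.bind_writes, Counted.ret_reads,
        Counted.ret_writes, InfoCorrect, potential, height, critDepth,
        Option.elim_some, Option.isSome_some, Option.mem_def, Option.some.injEq,
        forall_eq', weight]
      refine ⟨⟨by omega, il, hc3⟩,
        ⟨i, by simpa using hi, rebalance_attach_leveled hα hnl hc2 hl, hr'⟩, rfl, ?_, ?_⟩ <;> omega

/-- If attaching a leaf makes the root overflow, the potential pays for a reconstruction. -/
lemma weight_le_of_overflows {k : K} {t : LTree K} (hc : t.InfoCorrect) (hr : t.RootCritical)
    (ho : Overflows (rootInfo (attach k t).val)) :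
    t.weight + 1 ≤ 2 * t.potential + 2 * t.critDepth := by
  cases t with
  | nil => simp [attach, rootInfo, Overflows] at ho
  | node l x b info r =>
    obtain ⟨c, rfl⟩ := Option.isSome_iff_exists.1 hr
    have hw := hc.1 c rfl
    have ho' : 2 * c.initial ≤ c.weight + 1 := by
      simp only [attach, Counted.charge_val] at ho
      split_ifs at ho <;> exact ho
    simp only [potential, critDepth, Option.elim_some, Option.isSome_some, if_true]
    omega

end Paths

end General

/-! ### Validity, amortized cost of one update, and summation. -/

section Amortization

variable {K : Type u} [LinearOrder K]

open LTree

/-- The invariant of the data structure. -/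
structure DynTree.Valid (α : ℕ) (d : DynTree K) (S : Finset K) : Prop where
  represents : d.Represents S
  rootLeveled : d.tree.RootLeveled α
  dead_le : 2 * d.dead ≤ d.tree.entries.length

/-- The potential that pays for reconstructions. -/
def DynTree.potential (d : DynTree K) : ℕ := d.tree.potential + d.dead

lemma valid_build {α : ℕ} (hα : 2 ≤ α) {a : List (K × Bool)} {S : Finset K}
    (ha : (a.map Prod.fst).Pairwise (· < ·)) (hlive : ∀ e ∈ a, e.2 = true)
    (hS : ∀ k, (k, true) ∈ a ↔ k ∈ S) :
    DynTree.Valid α ⟨(build α true a).val, 0⟩ S where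
  represents := by
    refine ⟨?_, ?_, ?_, build_rootCritical _ _, build_infoCorrect _ _ _⟩ <;>
      simp only [build_entries]
    · exact ha
    · exact hS
    · symm
      rw [List.length_eq_zero_iff, List.filter_eq_nil_iff]
      intro e he
      simp [hlive e he]
  rootLeveled := build_rootLeveled hα _
  dead_le := by simp

lemma valid_rebuildAll {α : ℕ} (hα : 2 ≤ α) {t : LTree K} {S : Finset K} (ht : t.Sorted)
    (hS : ∀ k, (k, true) ∈ t.entries ↔ k ∈ S) :
    DynTree.Valid α ⟨(rebuildAll α t).val, 0⟩ S := by
  have h : (rebuildAll α t).val = (build α true (t.entries.filter Prod.snd)).val := by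
    simp [rebuildAll, flatten_val]
  rw [h]
  refine valid_build hα ?_ (fun e he => (List.mem_filter.1 he).2) fun k => ?_
  · exact ht.sublist (List.filter_sublist.map _)
  · simp [hS]

lemma valid_construct {α : ℕ} (hα : 2 ≤ α) (S : Finset K) : (construct α S).Valid α S := by
  refine valid_build hα ?_ ?_ ?_
  · simpa [Function.comp_def] using S.sortedLT_sort.pairwise
  · simp
  · simp

lemma construct_potential (α : ℕ) (S : Finset K) : (construct α S).potential = 0 := by
  simp [construct, DynTree.potential, build_potential]

lemma sorted_middle {p q : List (K × Bool)} {k : K} {b : Bool}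
    (h : ((p ++ (k, b) :: q).map Prod.fst).Pairwise (· < ·)) :
    (∀ e ∈ p, e.1 < k) ∧ ∀ e ∈ q, k < e.1 := by
  simp only [List.map_append, List.map_cons, List.pairwise_append, List.pairwise_cons,
    List.mem_map, List.mem_cons] at h
  exact ⟨fun e he => h.2.2 _ ⟨e, he, rfl⟩ _ (Or.inl rfl), fun e he => h.2.1.1 _ ⟨e, he, rfl⟩⟩

/-- The live keys after changing the flag of one key. -/
lemma live_middle_iff {p q : List (K × Bool)} {k x : K} {v : Bool}
    (hp : ∀ e ∈ p, e.1 < k) (hq : ∀ e ∈ q, k < e.1) :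
    (x, true) ∈ p ++ (k, v) :: q ↔ (x = k ∧ v = true) ∨ (x ≠ k ∧ (x, true) ∈ p ++ q) := by
  by_cases hx : x = k
  · subst hx
    have h1 : (x, true) ∉ p := fun h => lt_irrefl _ (hp _ h)
    have h2 : (x, true) ∉ q := fun h => lt_irrefl _ (hq _ h)
    simp [h1, h2, eq_comm]
  · simp [hx]

/-- The live entries are in bijection with `S`, and at most half of the entries are marked. -/
lemma DynTree.Valid.length_le {α : ℕ} {d : DynTree K} {S : Finset K} (h : d.Valid α S) :
    d.tree.entries.length ≤ 2 * S.card := by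
  obtain ⟨⟨h1, h2, h3, -, -⟩, -, h4⟩ := h
  have h5 : ((d.tree.entries.filter Prod.snd).map Prod.fst).Nodup :=
    (h1.sublist (List.filter_sublist.map _)).imp (fun h => h.ne)
  have h6 : ((d.tree.entries.filter Prod.snd).map Prod.fst).toFinset = S := by
    ext k; simp [h2]
  have h7 := List.toFinset_card_of_nodup h5
  rw [h6, List.length_map] at h7
  have h8 : (d.tree.entries.filter Prod.snd).length +
      (d.tree.entries.filter fun e => !e.2).length = d.tree.entries.length := by
    generalize d.tree.entries = a
    induction a with
    | nil => rfl
    | cons e a ih => cases he : e.2 <;> simp [he] <;> omega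
  omega

lemma DynTree.Valid.bounds {α : ℕ} (hα : 2 ≤ α) {d : DynTree K} {S : Finset K}
    (h : d.Valid α S) :
    ∃ i, α ^ i ≤ S.card + 1 ∧ d.tree.critDepth ≤ i + 3 ∧
      d.tree.height ≤ 8 * α + 3 + (8 * α + 1) * i := by
  obtain ⟨i, h1, h2, h3⟩ :=
    h.rootLeveled.bounds hα h.represents.2.2.2.2 h.represents.2.2.2.1
  have := h.length_le
  have := d.tree.weight_eq
  exact ⟨i, by omega, h2, h3⟩

/-- The result of one update is valid, and its amortized numbers of reads and writes are bounded by
the height of the tree and by the number of critical nodes on a path. -/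
def AmortizedStep (α : ℕ) (d : DynTree K) (c : Counted (DynTree K)) (S : Finset K) : Prop :=
  c.val.Valid α S ∧
  c.reads + 12 * c.val.potential ≤
    12 * d.potential + 12 * d.tree.critDepth + 3 * d.tree.height + 20 ∧
  c.writes + 12 * c.val.potential ≤ 12 * d.potential + 13 * d.tree.critDepth + 20

lemma amortizedStep_insert {α : ℕ} (hα : 2 ≤ α) {d : DynTree K} {S : Finset K}
    (h : d.Valid α S) (k : K) :
    AmortizedStep α d (insertKey α k d) (insert k S) := by
  obtain ⟨⟨h1, h2, h3, h4, h5⟩, h6, h7⟩ := h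
  have hsr := search_reads_le k d.tree
  have hsw := search_writes k d.tree
  unfold AmortizedStep
  simp only [insertKey, Counted.bind_val, Counted.bind_reads, Counted.bind_writes]
  rcases hs : (search k d.tree).val with _ | (_ | _)
  · have hk := ne_of_search_eq_none h1 hs
    obtain ⟨p, q, hpq, hpq', hp, hq⟩ := attach_entries h1 hk
    have har := attach_reads_le k d.tree
    have haw := attach_writes_le k d.tree
    have hmap : ((attach k d.tree).val).Sorted := by
      rw [hpq] at h1
      simp only [Sorted, hpq', List.map_append, List.map_cons, List.pairwise_append,
        List.pairwise_cons, List.mem_cons, List.mem_map] at h1 ⊢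
      refine ⟨h1.1, ⟨?_, h1.2.1⟩, ?_⟩
      · rintro _ ⟨e, he, rfl⟩; exact hq e he
      · rintro _ ⟨e, he, rfl⟩ y (rfl | hy)
        · exact hp e he
        · exact h1.2.2 _ ⟨e, he, rfl⟩ y hy
    have hlive : ∀ x, (x, true) ∈ (attach k d.tree).val.entries ↔ x ∈ insert k S := by
      intro x
      rw [hpq', live_middle_iff hp hq, ← hpq, h2, Finset.mem_insert]
      tauto
    have hdead : d.dead =
        ((attach k d.tree).val.entries.filter fun e => !e.2).length := by
      rw [hpq', h3, hpq]; simp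
    have hlen := attach_weight k d.tree
    have hwe := d.tree.weight_eq
    rw [weight_eq] at hlen
    simp only [Counted.bind_val, Counted.bind_reads, Counted.bind_writes, Counted.charge_val,
      Counted.charge_reads, Counted.charge_writes]
    by_cases ho : Overflows (rootInfo (attach k d.tree).val)
    · have hw := weight_le_of_overflows h5 h4 ho
      have hr := rebuildAll_reads_le α (attach k d.tree).val
      have hr' := rebuildAll_writes_le α (attach k d.tree).val
      simp only [ho, if_true, Counted.bind_val, Counted.bind_reads, Counted.bind_writes,
        Counted.charge_val, Counted.charge_reads, Counted.charge_writes, Counted.ret_val,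
        Counted.ret_reads, Counted.ret_writes, DynTree.potential, rebuildAll_potential]
      exact ⟨valid_rebuildAll hα hmap hlive, by omega, by omega⟩
    · obtain ⟨r1, r2, r3, r4, r5⟩ := rebalanceBelowRoot_attach hα hk h5 h6 h4 ho
      simp only [ho, if_false, Counted.bind_val, Counted.bind_reads, Counted.bind_writes,
        Counted.ret_val, Counted.ret_reads, Counted.ret_writes, DynTree.potential]
      refine ⟨⟨⟨?_, ?_, ?_, r3, r1⟩, r2, ?_⟩, by omega, by omega⟩ <;>
        simp only [rebalanceBelowRoot_entries]
      · exact hmap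
      · exact hlive
      · exact hdead
      · omega
  · have hk := mem_of_search_eq_some hs
    obtain ⟨p, q, hpq, hpq'⟩ := setLive_entries (v := true) h1 hk
    obtain ⟨hp, hq⟩ := sorted_middle (hpq ▸ h1)
    have har := setLive_reads_le k true d.tree
    have haw := setLive_writes_le k true d.tree
    have hpot := setLive_potential k true d.tree
    have hlen : d.tree.entries.length = (setLive k true d.tree).val.entries.length := by
      rw [hpq, hpq']; simp
    -- The revived key was itself marked, so `d.dead` is positive and the truncated `d.dead - 1` is
    -- a true subtraction.
    have hd : d.dead = ((p ++ q).filter fun e => !e.2).length + 1 := by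
      rw [h3, hpq]; simp; omega
    simp only [Counted.bind_val, Counted.bind_reads, Counted.bind_writes, Counted.charge_val,
      Counted.charge_reads, Counted.charge_writes, Counted.ret_val, Counted.ret_reads,
      Counted.ret_writes, DynTree.potential]
    refine ⟨⟨⟨?_, ?_, ?_, setLive_rootCritical _ h4, setLive_infoCorrect _ h5⟩,
      setLive_rootLeveled _ h6, ?_⟩, by omega, by omega⟩
    · simp only [hpq']
      simpa [hpq] using h1
    · intro x
      have := h2 x
      rw [hpq, live_middle_iff hp hq] at this
      simp only [hpq', live_middle_iff hp hq, Finset.mem_insert]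
      simp at this ⊢
      tauto
    · simp only [hpq', hd]; simp
    · simp only; omega
  · have hk := (h2 k).1 (mem_of_search_eq_some hs)
    simp only [Counted.ret_val, Counted.ret_reads, Counted.ret_writes]
    rw [Finset.insert_eq_of_mem hk]
    exact ⟨⟨⟨h1, h2, h3, h4, h5⟩, h6, h7⟩, by omega, by omega⟩

lemma amortizedStep_delete {α : ℕ} (hα : 2 ≤ α) {d : DynTree K} {S : Finset K}
    (h : d.Valid α S) (k : K) :
    AmortizedStep α d (deleteKey α k d) (S.erase k) := by
  obtain ⟨⟨h1, h2, h3, h4, h5⟩, h6, h7⟩ := h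
  have hsr := search_reads_le k d.tree
  have hsw := search_writes k d.tree
  have hnot : k ∉ S → AmortizedStep α d ⟨d, (search k d.tree).reads, (search k d.tree).writes⟩
      (S.erase k) := by
    intro hk
    rw [Finset.erase_eq_of_notMem hk]
    exact ⟨⟨⟨h1, h2, h3, h4, h5⟩, h6, h7⟩, by simp only; omega, by simp only; omega⟩
  rcases hs : (search k d.tree).val with _ | (_ | _)
  · have := hnot fun hk => ne_of_search_eq_none h1 hs _ ((h2 k).2 hk) rfl
    simpa [deleteKey, Counted.bind, hs] using this
  · have hk := mem_of_search_eq_some hs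
    obtain ⟨p, q, hpq, -⟩ := setLive_entries (v := true) h1 hk
    obtain ⟨hp, hq⟩ := sorted_middle (hpq ▸ h1)
    have := hnot fun hk' => by
      have h8 := (h2 k).2 hk'
      rw [hpq, live_middle_iff hp hq] at h8
      simp at h8
    simpa [deleteKey, Counted.bind, hs] using this
  · have hk := mem_of_search_eq_some hs
    obtain ⟨p, q, hpq, hpq'⟩ := setLive_entries (v := false) h1 hk
    obtain ⟨hp, hq⟩ := sorted_middle (hpq ▸ h1)
    have har := setLive_reads_le k false d.tree
    have haw := setLive_writes_le k false d.tree
    have hpot := setLive_potential k false d.tree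
    have hlen : d.tree.entries.length = (setLive k false d.tree).val.entries.length := by
      rw [hpq, hpq']; simp
    have hd : d.dead = ((p ++ q).filter fun e => !e.2).length := by
      rw [h3, hpq]; simp
    have hsorted : (setLive k false d.tree).val.Sorted := by
      simp only [Sorted, hpq']
      simpa [hpq] using h1
    have hlive : ∀ x, (x, true) ∈ (setLive k false d.tree).val.entries ↔ x ∈ S.erase k := by
      intro x
      have := h2 x
      rw [hpq, live_middle_iff hp hq] at this
      rw [hpq', live_middle_iff hp hq, Finset.mem_erase]
      simp at this ⊢
      tauto
    have hc' := setLive_infoCorrect (k := k) false h5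
    have hr' := setLive_rootCritical (k := k) false h4
    have hroot := rootInfo_weight hc' hr'
    rw [weight_eq] at hroot
    unfold AmortizedStep
    simp only [deleteKey, Counted.bind_val, Counted.bind_reads, Counted.bind_writes, hs,
      Counted.charge_val, Counted.charge_reads, Counted.charge_writes]
    split_ifs with ho
    -- The test gives `length ≤ 2 * (d.dead + 1)`. At five writes per node this is about ten per
    -- marked node, covered by the factor `12`; the remainder fits in the constant `20`.
    · have hr := rebuildAll_reads_le α (setLive k false d.tree).val
      have hr' := rebuildAll_writes_le α (setLive k false d.tree).val
      simp only [Counted.bind_val, Counted.bind_reads, Counted.bind_writes,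
        Counted.charge_val, Counted.charge_reads, Counted.charge_writes, Counted.ret_val,
        Counted.ret_reads, Counted.ret_writes, DynTree.potential, rebuildAll_potential]
      exact ⟨valid_rebuildAll hα hsorted hlive, by omega, by omega⟩
    · simp only [Counted.ret_val, Counted.ret_reads, Counted.ret_writes, DynTree.potential]
      refine ⟨⟨⟨hsorted, hlive, ?_, hr', hc'⟩, setLive_rootLeveled _ h6, ?_⟩,
        by omega, by omega⟩
      · simp only [hpq', hd]; simp; omega
      · simp only; omega

lemma amortizedStep_perform {α : ℕ} (hα : 2 ≤ α) {d : DynTree K} {S : Finset K}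
    (h : d.Valid α S) (u : Update K) : AmortizedStep α d (u.perform α d) (u.apply S) := by
  cases u with
  | insert k => exact amortizedStep_insert hα h k
  | delete k => exact amortizedStep_delete hα h k

/-- Reads and `ω` times writes each carry `12` times the potential, whence the factor `12 * (1 +
ω)`. -/
lemma AmortizedStep.work_le {α : ℕ} (hα : 2 ≤ α) {ω : ℝ} (hω : 1 ≤ ω) {d : DynTree K}
    {S T : Finset K} {c : Counted (DynTree K)} (h : d.Valid α S) (hc : AmortizedStep α d c T) :
    c.work ω + 12 * (1 + ω) * c.val.potential ≤ 12 * (1 + ω) * d.potential +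
      88 * ((ω + α) * max 1 (Real.logb α ((S.card + 1 : ℕ) : ℝ))) := by
  obtain ⟨i, hi, hdepth, hheight⟩ := h.bounds hα
  obtain ⟨-, hr, hw⟩ := hc
  have hα' : (2 : ℝ) ≤ α := by exact_mod_cast hα
  set M := max 1 (Real.logb α ((S.card + 1 : ℕ) : ℝ)) with hM
  have hM1 : 1 ≤ M := le_max_left _ _
  have hiM : (i : ℝ) ≤ M := by
    refine le_trans ?_ (le_max_right _ _)
    rw [Real.le_logb_iff_rpow_le (by linarith) (by positivity), Real.rpow_natCast]
    exact_mod_cast hi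
  have hr2 : c.reads + 12 * c.val.potential ≤
      12 * d.potential + (24 * α + 65 + (24 * α + 15) * i) := by
    have : 3 * ((8 * α + 1) * i) + 12 * i = (24 * α + 15) * i := by ring
    omega
  have hw2 : c.writes + 12 * c.val.potential ≤ 12 * d.potential + (59 + 13 * i) := by omega
  have hr3 : (c.reads : ℝ) + 12 * c.val.potential ≤
      12 * d.potential + (24 * α + 65 + (24 * α + 15) * i) := by exact_mod_cast hr2
  have hw3 : (c.writes : ℝ) + 12 * c.val.potential ≤ 12 * d.potential + (59 + 13 * i) := by
    exact_mod_cast hw2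
  have e1 : (24 * (α : ℝ) + 15) * i ≤ (24 * α + 15) * M := by gcongr
  have e2 : (24 * (α : ℝ) + 65) * 1 ≤ (24 * α + 65) * M := by gcongr
  have e3 : 2 * M ≤ α * M := by gcongr
  -- The read bound is at most `(48α + 80) * M`, and `80 ≤ 40α`; this is where `88` comes from. The
  -- writes need only `72 * M`.
  have hr4 : (c.reads : ℝ) + 12 * c.val.potential ≤ 12 * d.potential + 88 * (α * M) := by
    linarith
  have hw4 : (c.writes : ℝ) + 12 * c.val.potential ≤ 12 * d.potential + 88 * M := by
    linarith
  have hw5 := mul_le_mul_of_nonneg_left hw4 (zero_le_one.trans hω)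
  unfold Counted.work
  linarith

lemma performAll_spec {α : ℕ} (hα : 2 ≤ α) {ω : ℝ} (hω : 1 ≤ ω) (us : List (Update K))
    {d : DynTree K} {S : Finset K} (h : d.Valid α S) :
    (performAll α us d).val.Valid α (applyAll us S) ∧
    (performAll α us d).work ω ≤ 12 * (1 + ω) * d.potential +
      88 * ((sizes us S).map fun n : ℕ =>
        (ω + (α : ℝ)) * max 1 (Real.logb (α : ℝ) (n : ℝ))).sum := by
  induction us generalizing d S with
  | nil =>
    refine ⟨h, ?_⟩
    simp only [performAll, Counted.work, Counted.ret_reads, Counted.ret_writes, sizes,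
      List.map_nil, List.sum_nil]
    push_cast
    -- The sum telescopes, and the potential left at the end is dropped.
    have : 0 ≤ 12 * (1 + ω) * (d.potential : ℝ) := by positivity
    linarith
  | cons u us ih =>
    have hstep := amortizedStep_perform hα h u
    have hwork := hstep.work_le hα hω h
    obtain ⟨hv, hw⟩ := ih hstep.1
    refine ⟨hv, ?_⟩
    simp only [performAll, sizes, List.map_cons, List.sum_cons, Counted.work,
      Counted.bind_reads, Counted.bind_writes] at hwork hw ⊢
    push_cast at hwork hw ⊢
    linarith

end Amortization

end AlphaLabeling

theorem mainTheorem5 :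
    ∃ C : ℝ, 0 < C ∧
      ∀ (K : Type u) [LinearOrder K] (α : ℕ) (ω : ℝ), 2 ≤ α → 1 ≤ ω →
        ∀ (S : Finset K) (us : List (AlphaLabeling.Update K)),
          (AlphaLabeling.performAll α us
              (AlphaLabeling.construct α S)).val.Represents (AlphaLabeling.applyAll us S) ∧
          (AlphaLabeling.performAll α us (AlphaLabeling.construct α S)).work ω ≤
            C * ((AlphaLabeling.sizes us S).map fun n : ℕ =>
              (ω + (α : ℝ)) * max 1 (Real.logb (α : ℝ) (n : ℝ))).sum := by
  refine ⟨88, by norm_num, fun K _ α ω hα hω S us => ?_⟩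
  obtain ⟨h1, h2⟩ :=
    AlphaLabeling.performAll_spec hα hω us (AlphaLabeling.valid_construct hα S)
  -- A fresh tree has potential `0`, so no additive term depending on `S` remains.
  rw [AlphaLabeling.construct_potential] at h2
  exact ⟨h1.represents, by simpa using h2⟩
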